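/- **Theorem 3.5.** Let $\varepsilon\in\{1,0,-1\}$ and let $\mathbb Q^{n+1}_\varepsilon$ be the unit sphere $\mathbb S^{n+1}\subset\mathbb R^{n+2}$ if $\varepsilon=1$, the Euclidean space $\mathbb R^{n+1}$ if $\varepsilon=0$, and the hyperbolic space $\{x\in\mathbb L^{n+2}:\langle x,x\rangle=-1,\ x_1>0\}$ in the Lorentz space $\mathbb L^{n+2}$ (with $\langle x,y\rangle=-x_1y_1+\sum_{i\ge2}x_iy_i$) if $\varepsilon=-1$. Put $(C_\varepsilon(\mu),S_\varepsilon(\mu))=(\cos\mu,\sin\mu)$, $(1,\mu)$, $(\cosh\mu,\sinh\mu)$ for $\varepsilon=1,0,-1$ respectively. Let $F:M^n\to\mathbb Q^{n+1}_\varepsilon$ be a connected smooth immersed hypersurface oriented by a smooth unit normal field $N$, with second fundamental form $II(v,w)=-\langle dN(v),dF(w)\rangle$. The principal curvatures are the eigenvalues (with multiplicity) of $II$ with respect to the induced metric, and the mean curvature $H$ is their sum; assume $H>0$ everywhere on $M$. $F$ is *isoparametric* if its principal curvatures are constant on $M$. Let $I\subset\mathbb R$ be a nondegenerate interval with $0\in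 I$. A family $F^t:M\to\mathbb Q^{n+1}_\varepsilon$, $t\in I$, of smooth immersed hypersurfaces is a *solution on $I$ to the inverse mean curvature flow with initial data $F$* if $F^0=F$ and each $F^t$ has a smooth unit normal field $N^t$ whose mean curvature $H^t$ is positive on $M$, with $$\frac{\partial F^t}{\partial t}(x)=-\frac1{H^t(x)}N^t(x)\qquad\text{for all }(x,t)\in M\times I.$$ It is a *solution by parallel hypersurfaces* if moreover there is a function $\mu:I\to\mathbb R$ with $F^t(x)=C_\varepsilon(\mu(t))F(x)+S_\varepsilon(\mu(t))N(x)$ for all $(x,t)\in M\times I$. Then $F$ is the initial data of a solution by parallel hypersurfaces (on some such $I$) if and only if $F$ is isoparametric. Moreover, let $F$ be isoparametric with principal curvatures $k_1,\dots,k_n$. For every nondegenerate interval $I\ni0$, the solutions on $I$ by parallel hypersurfaces with initial data $F$ are exactly the families $$F^t(x)=C_\varepsilon(\mu(t))F(x)+S_\varepsilon(\mu(t))N(x),\qquad (x,t)\in M\times I,$$ where $\mu:I\to\mathbb R$ is a smooth function with $$\mu(0)=0,\qquad \prod_{i=1}^n\bigl(C_\varepsilon(\mu(t))-k_iS_\varepsilon(\mu(t))\bigr)=e^t\quad\text{for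 all }t\in I.$$ On each $I$ there is at most one such $\mu$, and on some open interval $I\ni0$ there is one. -/

import Mathlib

open scoped Manifold ContDiff

noncomputable section

namespace SpaceForm

/-- `1` for the curved space forms (which sit in a linear space of one dimension more), `0` for the
Euclidean one. -/
def extra : SignType → ℕ
  | .zero => 0
  | .neg => 1
  | .pos => 1

/-- The linear space containing the space form of dimension `n + 1` and curvature `ε`:
`ℝ^(n+1)` for `ε = 0`, and `ℝ^(n+2)` for `ε = 1` and `ε = -1`. -/
abbrev Ambient (ε : SignType) (n : ℕ) : Type := EuclideanSpace ℝ (Fin (n + extra ε + 1))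

/-- The standard bilinear form: the Euclidean scalar product for `ε = 0, 1`, and the Lorentz product
`-x₀ y₀ + ∑_{i ≥ 1} x_i y_i` for `ε = -1`. -/
def ip {ε : SignType} {n : ℕ} (x y : Ambient ε n) : ℝ :=
  ∑ i, (if ε = -1 ∧ i = 0 then -1 else 1) * (x i * y i)

/-- The simply connected space form of dimension `n + 1` and curvature `ε`: the whole Euclidean
space, the unit sphere, or the upper sheet of the hyperboloid. -/
def Q (ε : SignType) (n : ℕ) : Set (Ambient ε n) :=
  match ε with
  | .zero => Set.univ
  | .pos => {x | ip x x = 1}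
  | .neg => {x | ip x x = -1 ∧ 0 < x 0}

/-- The generalized cosine. -/
def C : SignType → ℝ → ℝ
  | .pos, μ => Real.cos μ
  | .zero, _ => 1
  | .neg, μ => Real.cosh μ

/-- The generalized sine. -/
def S : SignType → ℝ → ℝ
  | .pos, μ => Real.sin μ
  | .zero, μ => μ
  | .neg, μ => Real.sinh μ

section Hypersurface

variable {ε : SignType} {n : ℕ} {M : Type*} [TopologicalSpace M]
  [ChartedSpace (EuclideanSpace ℝ (Fin n)) M]

/-- The differential at `x` of a map into the ambient linear space. -/
def d (F : M → Ambient ε n) (x : M) : TangentSpace (𝓡 n) x →L[ℝ] Ambient ε n :=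
  mfderiv (𝓡 n) 𝓘(ℝ, Ambient ε n) F x

/-- The first fundamental form of `F` at `x`. -/
def firstForm (F : M → Ambient ε n) (x : M) (v w : TangentSpace (𝓡 n) x) : ℝ :=
  ip (d F x v) (d F x w)

/-- The second fundamental form of `F` at `x` with respect to the normal field `N`. -/
def secondForm (F N : M → Ambient ε n) (x : M) (v w : TangentSpace (𝓡 n) x) : ℝ :=
  -ip (d N x v) (d F x w)

/-- `F` is an oriented (immersed, smooth) hypersurface of the space form, the orientation being given
by the smooth unit normal field `N`, which is tangent to the space form. -/
structure IsOrientedHypersurface (F N : M → Ambient ε n) : Prop where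
  smooth : ContMDiff (𝓡 n) 𝓘(ℝ, Ambient ε n) ∞ F
  mem : ∀ x, F x ∈ Q ε n
  immersion : ∀ x, Function.Injective (d F x)
  normal_smooth : ContMDiff (𝓡 n) 𝓘(ℝ, Ambient ε n) ∞ N
  normal_tangent : ε ≠ 0 → ∀ x, ip (F x) (N x) = 0
  normal_unit : ∀ x, ip (N x) (N x) = 1
  normal_orthogonal : ∀ x v, ip (N x) (d F x v) = 0

/-- `k 0, …, k (n-1)` are the principal curvatures of `F` at `x` with respect to `N`, each repeated
according to its multiplicity: some orthonormal basis of the tangent space diagonalizes the second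
fundamental form, with diagonal entries `k i`. -/
def IsPrincipalCurvatures (F N : M → Ambient ε n) (x : M) (k : Fin n → ℝ) : Prop :=
  ∃ E : Fin n → TangentSpace (𝓡 n) x,
    (∀ i j, firstForm F x (E i) (E j) = if i = j then 1 else 0) ∧
    ∀ i j, secondForm F N x (E i) (E j) = if i = j then k i else 0

open Classical in
/-- The mean curvature: the sum of the principal curvatures. (On an oriented hypersurface principal
curvatures exist at every point; `meanCurvature_eq` says that the choice made here is immaterial.) -/
def meanCurvature (F N : M → Ambient ε n) (x : M) : ℝ :=
  if h : ∃ k, IsPrincipalCurvatures F N x k then ∑ i, h.choose i else 0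

/-- `ip` as a bilinear form. -/
def ipForm (ε : SignType) (n : ℕ) : LinearMap.BilinForm ℝ (Ambient ε n) :=
  LinearMap.mk₂ ℝ ip
    (fun x y z => by
      simp only [ip, ← Finset.sum_add_distrib, PiLp.add_apply]
      exact Finset.sum_congr rfl fun i _ => by ring)
    (fun c x y => by
      simp only [ip, Finset.mul_sum, PiLp.smul_apply, smul_eq_mul]
      exact Finset.sum_congr rfl fun i _ => by ring)
    (fun x y z => by
      simp only [ip, ← Finset.sum_add_distrib, PiLp.add_apply]
      exact Finset.sum_congr rfl fun i _ => by ring)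
    (fun c x y => by
      simp only [ip, Finset.mul_sum, PiLp.smul_apply, smul_eq_mul]
      exact Finset.sum_congr rfl fun i _ => by ring)

theorem sum_eq_of_diagonal {V : Type*} [AddCommGroup V] [Module ℝ V]
    (hf : FiniteDimensional ℝ V) (hV : Module.finrank ℝ V = n) (g h : LinearMap.BilinForm ℝ V) {E E' : Fin n → V}
    {k k' : Fin n → ℝ}
    (gE : ∀ i j, g (E i) (E j) = if i = j then 1 else 0)
    (hE : ∀ i j, h (E i) (E j) = if i = j then k i else 0)
    (gE' : ∀ i j, g (E' i) (E' j) = if i = j then 1 else 0)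
    (hE' : ∀ i j, h (E' i) (E' j) = if i = j then k' i else 0) :
    ∑ i, k i = ∑ i, k' i := by
  have li : LinearIndependent ℝ E := by
    rw [Fintype.linearIndependent_iff]
    intro a ha j
    have := congrArg (fun v => g v (E j)) ha
    simpa [LinearMap.sum_apply, gE] using this
  let b := basisOfLinearIndependentOfCardEqFinrank' E li (by rw [hV, Fintype.card_fin])
  have hb : ∀ j, ∑ i, b.repr (E' j) i • E i = E' j := fun j => by
    simpa [b] using b.sum_repr (E' j)
  let A : Matrix (Fin n) (Fin n) ℝ := Matrix.of fun j i => b.repr (E' j) i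
  have hA : A * A.transpose = 1 := by
    ext j l
    rw [Matrix.one_apply, ← gE' j l, ← hb j, ← hb l]
    simp [Matrix.mul_apply, A, LinearMap.sum_apply, gE, mul_comm]
  have hA' : A.transpose * A = 1 := mul_eq_one_comm.mp hA
  have hk' : ∀ j, k' j = ∑ i, A j i * A j i * k i := fun j => by
    have := hE' j j
    rw [if_pos rfl, ← hb j] at this
    rw [← this]
    simp [A, LinearMap.sum_apply, hE, mul_assoc]
  have hd : ∀ i, ∑ j, A j i * A j i = 1 := fun i => by
    simpa [Matrix.mul_apply] using congrFun (congrFun hA' i) i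
  simp only [hk']
  rw [Finset.sum_comm]
  simp only [← Finset.sum_mul, hd, one_mul]

/-- The sum of the principal curvatures does not depend on the diagonalizing basis. -/
theorem meanCurvature_eq {F N : M → Ambient ε n} {x : M} {k : Fin n → ℝ}
    (hk : IsPrincipalCurvatures F N x k) : meanCurvature F N x = ∑ i, k i := by
  have h : ∃ k, IsPrincipalCurvatures F N x k := ⟨k, hk⟩
  rw [meanCurvature, dif_pos h]
  obtain ⟨E, h1, h2⟩ := h.choose_spec
  obtain ⟨E', h1', h2'⟩ := hk
  exact sum_eq_of_diagonal (V := TangentSpace (𝓡 n) x)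
    (inferInstanceAs (FiniteDimensional ℝ (EuclideanSpace ℝ (Fin n))))
    (finrank_euclideanSpace_fin (𝕜 := ℝ) (n := n))
    ((ipForm ε n).compl₁₂ (d F x).toLinearMap (d F x).toLinearMap)
    (-(ipForm ε n).compl₁₂ (d N x).toLinearMap (d F x).toLinearMap)
    h1 h2 h1' h2'

/-- All the principal curvatures are constant on `M`, with values `k 0, …, k (n-1)`. -/
def HasConstantPrincipalCurvatures (F N : M → Ambient ε n) (k : Fin n → ℝ) : Prop :=
  ∀ x, IsPrincipalCurvatures F N x k

/-- The hypersurface is isoparametric. -/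
def IsIsoparametric (F N : M → Ambient ε n) : Prop :=
  ∃ k : Fin n → ℝ, HasConstantPrincipalCurvatures F N k

/-- The point at signed distance `μ` from `F x` along the geodesic of the space form that starts at
`F x` with velocity `N x`. -/
def parallel (F N : M → Ambient ε n) (μ : ℝ) (x : M) : Ambient ε n :=
  C ε μ • F x + S ε μ • N x

/-- A nondegenerate interval (open or not, bounded or not) that contains the initial time `0`. -/
structure IsTimeInterval (I : Set ℝ) : Prop where
  ordConnected : I.OrdConnected
  nontrivial : I.Nontrivial
  zero_mem : (0 : ℝ) ∈ I

/-- The family `G t`, `t ∈ I`, is a solution to the inverse mean curvature flow with initial data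
`F`: every `G t` is a hypersurface with a unit normal field `N' t` for which the mean curvature is
positive, and `∂G/∂t = -(1/H) N'` (the derivative being one-sided at an endpoint of `I` in `I`).
Values of `G` outside `I` play no role. -/
structure IsIMCF (F : M → Ambient ε n) (I : Set ℝ) (G : ℝ → M → Ambient ε n) : Prop where
  interval : IsTimeInterval I
  initial : ∀ x, G 0 x = F x
  flow : ∃ N' : ℝ → M → Ambient ε n, ∀ t ∈ I,
    IsOrientedHypersurface (G t) (N' t) ∧
    ∀ x, 0 < meanCurvature (G t) (N' t) x ∧
      HasDerivWithinAt (fun s => G s x) (-(1 / meanCurvature (G t) (N' t) x) • N' t x) I t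

/-- A solution to the inverse mean curvature flow by hypersurfaces parallel to the initial one. -/
structure IsIMCFByParallels (F N : M → Ambient ε n) (I : Set ℝ) (G : ℝ → M → Ambient ε n) :
    Prop where
  isIMCF : IsIMCF F I G
  isParallel : ∃ μ : ℝ → ℝ, ∀ t ∈ I, ∀ x, G t x = parallel F N (μ t) x

end Hypersurface

/-- `μ` is smooth on `I`, vanishes at `0`, and solves the algebraic equation
`∏ i, (C_ε(μ(t)) - k_i S_ε(μ(t))) = e^t` on `I`. -/
structure IsDistanceFunction (ε : SignType) {n : ℕ} (k : Fin n → ℝ) (I : Set ℝ) (μ : ℝ → ℝ) :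
    Prop where
  smooth : ContDiffOn ℝ ∞ μ I
  initial : μ 0 = 0
  equation : ∀ t ∈ I, ∏ i, (C ε (μ t) - k i * S ε (μ t)) = Real.exp t

end SpaceForm

end

/-! Write `c = C ε μ`, `s = S ε μ`. Where no factor `c - k i * s` vanishes, the parallel map `c F +
s N` is an immersion with normal `ν = -ε s F + c N` and principal curvatures `(ε s + k i c) / (c - k
i s)`; their sum is `parallelMean`. Since `∂/∂μ (c F + s N) = ν`, the flow reads `μ' = -1 /
parallelMean`. The logarithmic derivative of `∏ (c - k i s)` in `μ` is `-parallelMean`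
(`hasDerivWithinAt_prod`), so along the flow the product solves `p' = p`, `p 0 = 1`, and equals
`e^t`. Conversely, differentiating the algebraic equation gives the flow equation back.

In a given parallel solution `μ` is an arbitrary function, and its normals are known only up to
sign. Scalar products of `G t x` with `F x` and `N x` show that `c` and `s` are differentiable
(`IsFlowSystem`), and the sign cancels in `H⁻¹ N`. A smooth distance is then rebuilt from `c` and
`s` (`IsFlowSystem.exists_isDistanceFunction`).

Isoparametricity: `c` and `s` do not depend on the point, so the principal curvatures `k`, `k'` at
two points satisfy `∏ (c - k i s) = e^t = ∏ (c - k' i s)`. Dividing by `s^n`, the monic polynomials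
with roots `k` and `k'` agree at the infinitely many values `c / s`, so they coincide
(`IsFlowSystem.exists_perm`).

Existence is the inverse function theorem at `μ = 0`, uniqueness is Rolle's theorem. -/

open scoped Manifold ContDiff

noncomputable section

namespace SpaceForm

/-! ### Linear algebra of the ambient form -/

section Linear

variable {ε : SignType} {n : ℕ}

theorem ipForm_apply (x y : Ambient ε n) : ipForm ε n x y = ip x y := rfl

theorem ip_comm (x y : Ambient ε n) : ip x y = ip y x := by
  simp only [ip, mul_comm (x _)]

theorem ip_add_left (x y z : Ambient ε n) : ip (x + y) z = ip x z + ip y z := by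
  simp [← ipForm_apply]

theorem ip_add_right (x y z : Ambient ε n) : ip x (y + z) = ip x y + ip x z := by
  simp [← ipForm_apply]

theorem ip_smul_left (a : ℝ) (x y : Ambient ε n) : ip (a • x) y = a * ip x y := by
  simp [← ipForm_apply]

theorem ip_smul_right (a : ℝ) (x y : Ambient ε n) : ip x (a • y) = a * ip x y := by
  simp [← ipForm_apply]

theorem ip_zero_left (x : Ambient ε n) : ip 0 x = 0 := by
  simp [← ipForm_apply]

theorem eq_zero_of_forall_ip_eq_zero {w : Ambient ε n} (h : ∀ x, ip w x = 0) : w = 0 := by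
  ext i
  have := h (EuclideanSpace.single i 1)
  simp only [ip, PiLp.single_apply, mul_ite, mul_one, mul_zero, Finset.sum_ite_eq',
    Finset.mem_univ, if_true] at this
  split_ifs at this <;> simpa using this

/-- A vector orthogonal to a full orthogonal frame without null vectors vanishes. -/
theorem eq_zero_of_orthogonal_family {ι : Type*} [Fintype ι]
    (hι : Fintype.card ι = n + extra ε + 1) (f : ι → Ambient ε n)
    (hne : ∀ i, ip (f i) (f i) ≠ 0) (hort : ∀ i j, i ≠ j → ip (f i) (f j) = 0)
    {w : Ambient ε n} (hw : ∀ i, ip w (f i) = 0) : w = 0 := by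
  classical
  have li : LinearIndependent ℝ f := by
    rw [Fintype.linearIndependent_iff]
    intro a ha j
    have := congrArg (fun v => ipForm ε n v (f j)) ha
    simp only [map_sum, LinearMap.sum_apply, map_smul, LinearMap.smul_apply, ipForm_apply,
      map_zero, LinearMap.zero_apply, smul_eq_mul] at this
    rw [Finset.sum_eq_single j (fun i _ hij => by rw [hort i j hij, mul_zero]) (by simp)] at this
    exact (mul_eq_zero.mp this).resolve_right (hne j)
  rcases isEmpty_or_nonempty ι with h | h
  · simp at hι
  let b := basisOfLinearIndependentOfCardEqFinrank li (by rw [hι, finrank_euclideanSpace_fin])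
  have h0 : ipForm ε n w = 0 := b.ext fun i => by simp [b, ipForm_apply, hw]
  exact eq_zero_of_forall_ip_eq_zero fun x => by rw [← ipForm_apply, h0]; rfl

/-- A vector orthogonal to the position vector, the normal and an orthonormal tangent basis
vanishes. -/
theorem eq_zero_of_orthogonal_frame {P ν : Ambient ε n} {e : Fin n → Ambient ε n}
    (hP : ε ≠ 0 → ip P P ≠ 0) (hν : ip ν ν ≠ 0) (he : ∀ i j, ip (e i) (e j) = if i = j then 1 else 0)
    (hPν : ε ≠ 0 → ip P ν = 0) (hPe : ε ≠ 0 → ∀ i, ip P (e i) = 0) (hνe : ∀ i, ip ν (e i) = 0)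
    {w : Ambient ε n} (hwP : ε ≠ 0 → ip w P = 0) (hwν : ip w ν = 0) (hwe : ∀ i, ip w (e i) = 0) :
    w = 0 := by
  have hε : Fin (extra ε) → ε ≠ 0 := by
    rintro j rfl
    exact j.elim0
  have hsub : Subsingleton (Fin (extra ε)) := by
    cases ε <;> simp only [extra] <;> infer_instance
  -- The middle summand is empty for `ε = 0`, where the position vector is not part of the frame.
  refine eq_zero_of_orthogonal_family (ι := Fin n ⊕ Fin (extra ε) ⊕ Unit) (by simp [add_assoc])
    (Sum.elim e (Sum.elim (fun _ => P) fun _ => ν)) ?_ ?_ ?_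
  · rintro (i | i | i)
    · simp [he]
    · exact hP (hε i)
    · exact hν
  · rintro (i | i | i) (j | j | j) hij
    · simpa [he] using hij
    · exact (ip_comm _ _).trans (hPe (hε j) i)
    · exact (ip_comm _ _).trans (hνe i)
    · exact hPe (hε i) j
    · exact absurd (by rw [Subsingleton.elim i j]) hij
    · exact hPν (hε i)
    · exact hνe j
    · exact (ip_comm _ _).trans (hPν (hε j))
    · exact absurd rfl hij
  · rintro (i | i | i)
    · exact hwe i
    · exact hwP (hε i)
    · exact hwν

/-- `ip` as a continuous bilinear map. -/
def ipCLM (ε : SignType) (n : ℕ) : Ambient ε n →L[ℝ] Ambient ε n →L[ℝ] ℝ :=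
  LinearMap.toContinuousLinearMap
    ((LinearMap.toContinuousLinearMap (𝕜 := ℝ) (E := Ambient ε n) (F' := ℝ)).toLinearMap ∘ₗ
      ipForm ε n)

end Linear

/-! ### Differentials of maps into the ambient space -/

section Differential

variable {ε : SignType} {n : ℕ} {M : Type*} [TopologicalSpace M]
  [ChartedSpace (EuclideanSpace ℝ (Fin n)) M] {F N : M → Ambient ε n}

theorem d_combination {x : M} (hF : MDifferentiableAt (𝓡 n) 𝓘(ℝ, Ambient ε n) F x)
    (hN : MDifferentiableAt (𝓡 n) 𝓘(ℝ, Ambient ε n) N x) (a b : ℝ) (v : TangentSpace (𝓡 n) x) :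
    d (fun y => a • F y + b • N y) x v = (a • d F x v + b • d N x v : Ambient ε n) := by
  have h := (hF.hasMFDerivAt.const_smul a).add (hN.hasMFDerivAt.const_smul b)
  have h' := h.mfderiv
  exact congrArg (fun A => A v) h'

/-- Product rule for a constant scalar product, carried out in a chart, where derivatives within the
range of the model are unique. It is the source of the orthogonality relations among `F`, `N` and
their differentials. -/
theorem ip_d_add_ip_d {x : M} (hF : MDifferentiableAt (𝓡 n) 𝓘(ℝ, Ambient ε n) F x)
    (hN : MDifferentiableAt (𝓡 n) 𝓘(ℝ, Ambient ε n) N x) {a : ℝ} (ha : ∀ y, ip (F y) (N y) = a)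
    (v : TangentSpace (𝓡 n) x) : ip (F x) (d N x v) + ip (d F x v) (N x) = 0 := by
  have h := (ipCLM ε n).hasFDerivWithinAt_of_bilinear hF.hasMFDerivAt.2 hN.hasMFDerivAt.2
  have hc : (fun y => ipCLM ε n (writtenInExtChartAt (𝓡 n) 𝓘(ℝ, Ambient ε n) x F y)
      (writtenInExtChartAt (𝓡 n) 𝓘(ℝ, Ambient ε n) x N y)) = fun _ => a := by
    funext y
    exact ha _
  rw [hc] at h
  have hu := (𝓡 n).uniqueDiffWithinAt_image (x := (chartAt (EuclideanSpace ℝ (Fin n)) x) x)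
  have h' := hu.eq h (hasFDerivWithinAt_const a _ _)
  have := congrArg (fun A => A v) h'
  have e1 : (extChartAt (𝓡 n) x).symm (extChartAt (𝓡 n) x x) = x := extChartAt_to_inv x
  simp only [writtenInExtChartAt, extChartAt_model_space_eq_id, PartialEquiv.refl_coe,
    Function.comp_apply, id_eq, e1] at this
  exact this

end Differential

/-! ### Geometry of parallel hypersurfaces -/

section Geometry

variable {ε : SignType} {n : ℕ} {M : Type*} [TopologicalSpace M]
  [ChartedSpace (EuclideanSpace ℝ (Fin n)) M] {F N N' : M → Ambient ε n}

theorem cast_mul_self_of_ne_zero (hε : ε ≠ 0) : (ε : ℝ) * ε = 1 := by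
  rcases ε.trichotomy with rfl | rfl | rfl <;> simp_all

theorem cast_ne_zero_of_ne_zero (hε : ε ≠ 0) : (ε : ℝ) ≠ 0 :=
  left_ne_zero_of_mul_eq_one (cast_mul_self_of_ne_zero hε)

theorem ip_self_of_mem_Q (hε : ε ≠ 0) {p : Ambient ε n} (hp : p ∈ Q ε n) : ip p p = ε := by
  rcases ε.trichotomy with rfl | rfl | rfl
  · simpa using hp.1
  · exact absurd rfl hε
  · simp only [SignType.coe_one]
    exact hp

namespace IsOrientedHypersurface

theorem mdifferentiableAt (h : IsOrientedHypersurface F N) (x : M) :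
    MDifferentiableAt (𝓡 n) 𝓘(ℝ, Ambient ε n) F x :=
  h.smooth.mdifferentiable (by simp) x

theorem mdifferentiableAt_normal (h : IsOrientedHypersurface F N) (x : M) :
    MDifferentiableAt (𝓡 n) 𝓘(ℝ, Ambient ε n) N x :=
  h.normal_smooth.mdifferentiable (by simp) x

theorem ip_self (h : IsOrientedHypersurface F N) (hε : ε ≠ 0) (x : M) : ip (F x) (F x) = ε :=
  ip_self_of_mem_Q hε (h.mem x)

theorem ip_d (h : IsOrientedHypersurface F N) (hε : ε ≠ 0) (x : M) (v : TangentSpace (𝓡 n) x) :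
    ip (F x) (d F x v) = 0 := by
  have := ip_d_add_ip_d (h.mdifferentiableAt x) (h.mdifferentiableAt x) (h.ip_self hε) v
  rw [ip_comm (d F x v)] at this
  linarith

theorem ip_normal_d_normal (h : IsOrientedHypersurface F N) (x : M) (v : TangentSpace (𝓡 n) x) :
    ip (N x) (d N x v) = 0 := by
  have := ip_d_add_ip_d (h.mdifferentiableAt_normal x) (h.mdifferentiableAt_normal x)
    h.normal_unit v
  rw [ip_comm (d N x v)] at this
  linarith

theorem ip_d_normal (h : IsOrientedHypersurface F N) (hε : ε ≠ 0) (x : M)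
    (v : TangentSpace (𝓡 n) x) : ip (F x) (d N x v) = 0 := by
  have := ip_d_add_ip_d (h.mdifferentiableAt x) (h.mdifferentiableAt_normal x)
    (h.normal_tangent hε) v
  rw [ip_comm (d F x v), h.normal_orthogonal] at this
  linarith

/-- A vector tangent to the space form and orthogonal to the hypersurface is normal. -/
theorem eq_zero_of_orthogonal (h : IsOrientedHypersurface F N) {x : M}
    {E : Fin n → TangentSpace (𝓡 n) x}
    (hE : ∀ i j, firstForm F x (E i) (E j) = if i = j then 1 else 0) {w : Ambient ε n}
    (hwF : ε ≠ 0 → ip w (F x) = 0) (hwN : ip w (N x) = 0) (hwE : ∀ i, ip w (d F x (E i)) = 0) :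
    w = 0 :=
  eq_zero_of_orthogonal_frame (P := F x) (ν := N x) (e := fun i => d F x (E i))
    (fun hε => by rw [h.ip_self hε]; exact cast_ne_zero_of_ne_zero hε)
    (by rw [h.normal_unit]; exact one_ne_zero) hE
    (fun hε => h.normal_tangent hε x) (fun hε i => h.ip_d hε x _)
    (fun i => h.normal_orthogonal x _) hwF hwN hwE

/-- The Weingarten equation in a principal basis. -/
theorem d_normal_eq (h : IsOrientedHypersurface F N) {x : M} {k : Fin n → ℝ}
    {E : Fin n → TangentSpace (𝓡 n) x}
    (hE : ∀ i j, firstForm F x (E i) (E j) = if i = j then 1 else 0)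
    (hE' : ∀ i j, secondForm F N x (E i) (E j) = if i = j then k i else 0) (i : Fin n) :
    (d N x (E i) : Ambient ε n) = (-k i) • (d F x (E i) : Ambient ε n) := by
  rw [← sub_eq_zero, sub_eq_add_neg, ← neg_smul, neg_neg]
  refine h.eq_zero_of_orthogonal hE (fun hε => ?_) ?_ fun j => ?_
  · rw [ip_comm, ip_add_right, ip_smul_right, h.ip_d hε, h.ip_d_normal hε, mul_zero, add_zero]
  · rw [ip_comm, ip_add_right, ip_smul_right, h.ip_normal_d_normal, h.normal_orthogonal, mul_zero,
      add_zero]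
  · have h1 := hE i j
    have h2 := hE' i j
    simp only [firstForm, secondForm] at h1 h2
    rw [ip_add_left, ip_smul_left, h1, ← neg_neg (ip (d N x (E i)) _), h2]
    split_ifs <;> ring

end IsOrientedHypersurface

/-- The linear combination of the position vector and the normal with constant coefficients. -/
def combination (F N : M → Ambient ε n) (a b : ℝ) (x : M) : Ambient ε n := a • F x + b • N x

namespace IsOrientedHypersurface

theorem d_combination (h : IsOrientedHypersurface F N) (a b : ℝ) (x : M)
    (v : TangentSpace (𝓡 n) x) :
    (d (combination F N a b) x v : Ambient ε n) = (a • d F x v + b • d N x v : Ambient ε n) :=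
  SpaceForm.d_combination (h.mdifferentiableAt x) (h.mdifferentiableAt_normal x) a b v

theorem d_combination_eq (h : IsOrientedHypersurface F N) {x : M} {k : Fin n → ℝ}
    {E : Fin n → TangentSpace (𝓡 n) x}
    (hE : ∀ i j, firstForm F x (E i) (E j) = if i = j then 1 else 0)
    (hE' : ∀ i j, secondForm F N x (E i) (E j) = if i = j then k i else 0) (a b : ℝ) (i : Fin n) :
    (d (combination F N a b) x (E i) : Ambient ε n) =
      (a - k i * b) • (d F x (E i) : Ambient ε n) := by
  rw [h.d_combination, h.d_normal_eq hE hE', smul_smul, ← add_smul]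
  congr 1
  ring

theorem contMDiff_combination (h : IsOrientedHypersurface F N) (a b : ℝ) :
    ContMDiff (𝓡 n) 𝓘(ℝ, Ambient ε n) ∞ (combination F N a b) := by
  have hc : ∀ r : ℝ, ContMDiff (𝓡 n) 𝓘(ℝ, ℝ) ∞ fun _ : M => r := fun r => contMDiff_const
  exact ((hc a).smul h.smooth).add ((hc b).smul h.normal_smooth)

theorem ip_combination (h : IsOrientedHypersurface F N) (hε : ε ≠ 0) (a b a' b' : ℝ) (x : M) :
    ip (combination F N a b x) (combination F N a' b' x) = ε * (a * a') + b * b' := by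
  simp only [combination, ip_add_left, ip_add_right, ip_smul_left, ip_smul_right, h.ip_self hε,
    h.normal_tangent hε, ip_comm (N x) (F x), h.normal_unit]
  ring

theorem ip_combination_normal (h : IsOrientedHypersurface F N) {c s : ℝ}
    (hcs : c ^ 2 + ε * s ^ 2 = 1) (x : M) :
    ip (combination F N (-(ε * s)) c x) (combination F N (-(ε * s)) c x) = 1 := by
  by_cases hε : ε = 0
  · subst hε
    simp only [SignType.coe_zero, zero_mul, add_zero] at hcs
    simp only [combination, SignType.coe_zero, zero_mul, neg_zero, zero_smul, zero_add,
      ip_smul_left, ip_smul_right, h.normal_unit]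
    linarith
  · rw [h.ip_combination hε]
    linear_combination hcs + ε * s ^ 2 * cast_mul_self_of_ne_zero hε

theorem ip_combination_tangent (h : IsOrientedHypersurface F N) (hε : ε ≠ 0) (c s : ℝ) (x : M) :
    ip (combination F N c s x) (combination F N (-(ε * s)) c x) = 0 := by
  rw [h.ip_combination hε]
  linear_combination -(c * s) * cast_mul_self_of_ne_zero hε

/-- In the Euclidean case the position vector need not be orthogonal to tangent vectors, so its
coefficient must vanish. -/
theorem ip_combination_d (h : IsOrientedHypersurface F N) (a b a' b' : ℝ) (ha : ε = 0 → a = 0)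
    (x : M) (v : TangentSpace (𝓡 n) x) :
    ip (combination F N a b x) (d (combination F N a' b') x v) = 0 := by
  rw [h.d_combination]
  simp only [combination, ip_add_left, ip_add_right, ip_smul_left, ip_smul_right,
    h.ip_normal_d_normal, h.normal_orthogonal]
  by_cases hε : ε = 0
  · simp [ha hε]
  · simp [h.ip_d hε, h.ip_d_normal hε]

/-- The principal directions are unchanged: `dF (E i)` is scaled by `c - k i s`, and dividing `E i`
by this factor restores orthonormality. The factor `σ` allows for either orientation. -/
theorem isPrincipalCurvatures_combination (h : IsOrientedHypersurface F N) {x : M} {k : Fin n → ℝ}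
    (hk : IsPrincipalCurvatures F N x k) {c s : ℝ} (hne : ∀ i, c - k i * s ≠ 0) {σ : ℝ}
    {N' : M → Ambient ε n} (hN' : N' =ᶠ[nhds x] combination F N (σ * -(ε * s)) (σ * c)) :
    IsPrincipalCurvatures (combination F N c s) N' x
      (fun i => σ * ((ε * s + k i * c) / (c - k i * s))) := by
  obtain ⟨E, hE, hE'⟩ := hk
  have hd : d N' x = d (combination F N (σ * -(ε * s)) (σ * c)) x := hN'.mfderiv_eq
  have e1 : ∀ i, ((c - k i * s)⁻¹ * (c - k i * s)) = 1 := fun i => inv_mul_cancel₀ (hne i)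
  have dG : ∀ i, (d (combination F N c s) x ((c - k i * s)⁻¹ • E i) : Ambient ε n) = d F x (E i) :=
    fun i => by
      rw [map_smul, h.d_combination_eq hE hE', smul_smul, e1, one_smul]
  have dN : ∀ i, (d N' x ((c - k i * s)⁻¹ • E i) : Ambient ε n) =
      (-(σ * ((ε * s + k i * c) / (c - k i * s)))) • (d F x (E i) : Ambient ε n) := fun i => by
    rw [hd, map_smul, h.d_combination_eq hE hE', smul_smul]
    congr 1
    ring
  refine ⟨fun i => (c - k i * s)⁻¹ • E i, fun i j => ?_, fun i j => ?_⟩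
  · rw [firstForm, dG, dG]
    exact hE i j
  · rw [secondForm, dG, dN, ip_smul_left]
    have h1 := hE i j
    simp only [firstForm] at h1
    rw [h1]
    split_ifs <;> simp

/-- Immersed parallel hypersurfaces have no focal points. -/
theorem sub_mul_ne_zero (h : IsOrientedHypersurface F N) {x : M} {k : Fin n → ℝ}
    (hk : IsPrincipalCurvatures F N x k) {c s : ℝ}
    (hi : Function.Injective (d (combination F N c s) x)) (i : Fin n) : c - k i * s ≠ 0 := by
  obtain ⟨E, hE, hE'⟩ := hk
  intro h0
  have h1 := h.d_combination_eq hE hE' c s i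
  rw [h0, zero_smul] at h1
  have h2 : E i = 0 := hi (h1.trans (map_zero _).symm)
  have h3 := hE i i
  rw [if_pos rfl, firstForm, h2, map_zero, ip_zero_left] at h3
  exact zero_ne_one h3

/-- The unit normals of a parallel hypersurface. -/
theorem exists_normal_eq (h : IsOrientedHypersurface F N) {c s : ℝ} (hcs : c ^ 2 + ε * s ^ 2 = 1)
    (h' : IsOrientedHypersurface (combination F N c s) N') {x : M} {k : Fin n → ℝ}
    (hk : IsPrincipalCurvatures F N x k) :
    N' x = ip (N' x) (combination F N (-(ε * s)) c x) • combination F N (-(ε * s)) c x := by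
  have hne := h.sub_mul_ne_zero hk (h'.immersion x)
  obtain ⟨E, hE, hE'⟩ := hk
  have hd : ∀ i, (d F x (E i) : Ambient ε n) =
      (c - k i * s)⁻¹ • (d (combination F N c s) x (E i) : Ambient ε n) := fun i => by
    rw [h.d_combination_eq hE hE', smul_smul, inv_mul_cancel₀ (hne i), one_smul]
  set ν := combination F N (-(ε * s)) c x with hν
  have ha : ε = 0 → -(ε * s) = 0 := by rintro rfl; simp
  rw [← sub_eq_zero, sub_eq_add_neg, ← neg_smul]
  -- The vectors `dF (E i)` also span the tangent space of the parallel hypersurface, so `N' - ⟨N',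
  -- ν⟩ ν` is orthogonal to a full frame.
  refine eq_zero_of_orthogonal_frame (P := combination F N c s x) (ν := ν)
    (e := fun i => d F x (E i)) (fun hε => ?_) ?_ hE (fun hε => h.ip_combination_tangent hε c s x)
    (fun hε i => ?_) (fun i => ?_) (fun hε => ?_) ?_ (fun i => ?_)
  · rw [h'.ip_self hε]; exact cast_ne_zero_of_ne_zero hε
  · rw [h.ip_combination_normal hcs]; exact one_ne_zero
  · rw [hd, ip_smul_right, h'.ip_d hε, mul_zero]
  · rw [hd, ip_smul_right, h.ip_combination_d _ _ _ _ ha, mul_zero]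
  · rw [ip_comm, ip_add_right, h'.normal_tangent hε, ip_smul_right,
      h.ip_combination_tangent hε, mul_zero, add_zero]
  · rw [ip_add_left, ip_smul_left, h.ip_combination_normal hcs]
    ring
  · rw [hd, ip_smul_right, ip_add_left, ip_smul_left, h'.normal_orthogonal,
      h.ip_combination_d _ _ _ _ ha]
    ring

/-- The mean curvature of a parallel hypersurface, and its normals up to sign. -/
theorem exists_sign (h : IsOrientedHypersurface F N) {c s : ℝ} (hcs : c ^ 2 + ε * s ^ 2 = 1)
    (h' : IsOrientedHypersurface (combination F N c s) N')
    (hk : ∀ y, ∃ k, IsPrincipalCurvatures F N y k) {x : M} {k : Fin n → ℝ}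
    (hx : IsPrincipalCurvatures F N x k) :
    ∃ σ : ℝ, σ * σ = 1 ∧ N' x = σ • combination F N (-(ε * s)) c x ∧
      meanCurvature (combination F N c s) N' x =
        σ * ∑ i, (ε * s + k i * c) / (c - k i * s) := by
  set σ : M → ℝ := fun y => ip (N' y) (combination F N (-(ε * s)) c y) with hσ
  have hN : ∀ y, N' y = σ y • combination F N (-(ε * s)) c y := fun y => by
    obtain ⟨k, hk⟩ := hk y
    exact h.exists_normal_eq hcs h' hk
  have hσσ : ∀ y, σ y * σ y = 1 := fun y => by
    have := h'.normal_unit y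
    rwa [hN y, ip_smul_left, ip_smul_right, h.ip_combination_normal hcs, mul_one] at this
  have hcont : Continuous σ := by
    have : σ = fun y => ipCLM ε n (N' y) (combination F N (-(ε * s)) c y) := rfl
    rw [this]
    exact ((ipCLM ε n).continuous.comp h'.normal_smooth.continuous).clm_apply
      (h.contMDiff_combination _ _).continuous
  -- A continuous function with values `±1` is locally constant, so `d N'` at `x` contains no
  -- derivative of `σ`.
  have hev : ∀ᶠ y in nhds x, σ y = σ x := by
    have : ∀ᶠ y in nhds x, 0 < σ y * σ x :=
      (hcont.mul (continuous_const (y := σ x))).continuousAt.eventually_const_lt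
        (show 0 < σ x * σ x from (hσσ x).symm ▸ one_pos)
    filter_upwards [this] with y hy
    nlinarith [hσσ x, hσσ y, sq_nonneg (σ x - σ y)]
  refine ⟨σ x, hσσ x, hN x, ?_⟩
  rw [meanCurvature_eq (h.isPrincipalCurvatures_combination hx
    (h.sub_mul_ne_zero hx (h'.immersion x)) (σ := σ x) ?_), Finset.mul_sum]
  filter_upwards [hev] with y hy
  rw [hN y, hy, combination, combination, smul_add, smul_smul, smul_smul]

/-- Parallel hypersurfaces stay in the space form. -/
theorem combination_mem_Q (h : IsOrientedHypersurface F N) {c s : ℝ} (hcs : c ^ 2 + ε * s ^ 2 = 1)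
    (hc : ε = -1 → 0 < c) (x : M) : combination F N c s x ∈ Q ε n := by
  rcases ε.trichotomy with rfl | rfl | rfl
  · have hε : (-1 : SignType) ≠ 0 := by decide
    refine ⟨?_, ?_⟩
    · rw [h.ip_combination hε]
      simp only [SignType.coe_neg, SignType.coe_one] at hcs ⊢
      linarith
    · have h1 := h.ip_self hε x
      have h2 := h.normal_tangent hε x
      have h3 := h.normal_unit x
      have h0 : 0 < F x 0 := (h.mem x).2
      have hc := hc rfl
      simp only [ip, Fin.sum_univ_succ, if_true, Fin.succ_ne_zero, and_false, and_true, if_false,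
        one_mul, SignType.coe_neg, SignType.coe_one] at h1 h2 h3 hcs
      -- Upper sheet: Cauchy–Schwarz on the spatial parts gives `1 + (N x 0)² ≤ (F x 0)²`, and `c² -
      -- s² = 1` gives `|s| < c`. Hence `c F x 0` dominates `|s N x 0|`.
      have cs := Finset.sum_mul_sq_le_sq_mul_sq Finset.univ (fun i => F x (Fin.succ i))
        (fun i => N x (Fin.succ i))
      simp only [sq] at cs
      have e2 : ∑ i : Fin (n + extra (-1)), F x i.succ * N x i.succ = F x 0 * N x 0 := by linarith
      have e1 : ∑ i : Fin (n + extra (-1)), F x i.succ * F x i.succ = F x 0 * F x 0 - 1 := by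
        linarith
      have e3 : ∑ i : Fin (n + extra (-1)), N x i.succ * N x i.succ = 1 + N x 0 * N x 0 := by
        linarith
      rw [e1, e2, e3] at cs
      have hN : |N x 0| < F x 0 := abs_lt_of_sq_lt_sq (by nlinarith) h0.le
      have hs : |s| < c := abs_lt_of_sq_lt_sq (by nlinarith) hc.le
      have hp : |s * N x 0| < c * F x 0 := by
        rw [abs_mul]
        exact mul_lt_mul'' hs hN (abs_nonneg _) (abs_nonneg _)
      have := (abs_lt.mp hp).1
      change 0 < c * F x 0 + s * N x 0
      linarith
  · trivial
  · have hε : (1 : SignType) ≠ 0 := by decide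
    change ip _ _ = 1
    rw [h.ip_combination hε]
    simp only [SignType.coe_one] at hcs ⊢
    linarith

theorem combination_isOrientedHypersurface (h : IsOrientedHypersurface F N) {c s : ℝ}
    (hcs : c ^ 2 + ε * s ^ 2 = 1) (hc : ε = -1 → 0 < c) {k : M → Fin n → ℝ}
    (hk : ∀ x, IsPrincipalCurvatures F N x (k x)) (hne : ∀ x i, c - k x i * s ≠ 0) :
    IsOrientedHypersurface (combination F N c s) (combination F N (-(ε * s)) c) where
  smooth := h.contMDiff_combination _ _
  mem := h.combination_mem_Q hcs hc
  immersion x := by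
    obtain ⟨E, hE, hE'⟩ := hk x
    have li : LinearIndependent ℝ E := by
      rw [Fintype.linearIndependent_iff]
      intro a ha j
      have := congrArg (fun v => (ipForm ε n).compl₁₂ (d F x).toLinearMap (d F x).toLinearMap v
        (E j)) ha
      have hE1 : ∀ i j, (ipForm ε n).compl₁₂ (d F x).toLinearMap (d F x).toLinearMap (E i) (E j) =
        if i = j then 1 else 0 := hE
      simp only [map_sum, LinearMap.sum_apply, map_smul, LinearMap.smul_apply, hE1, map_zero,
        LinearMap.zero_apply, smul_eq_mul, mul_ite, mul_one, mul_zero] at this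
      simpa using this
    have : FiniteDimensional ℝ (TangentSpace (𝓡 n) x) :=
      inferInstanceAs (FiniteDimensional ℝ (EuclideanSpace ℝ (Fin n)))
    have hfr : Module.finrank ℝ (TangentSpace (𝓡 n) x) = n :=
      finrank_euclideanSpace_fin (𝕜 := ℝ) (n := n)
    let b := basisOfLinearIndependentOfCardEqFinrank' E li (by rw [hfr, Fintype.card_fin])
    rw [injective_iff_map_eq_zero]
    intro v hv
    have hb : ∑ i, b.repr v i • E i = v := by simpa [b] using b.sum_repr v
    have hz : ∀ j, b.repr v j = 0 := fun j => by
      have h1 := congrArg (fun w => ip w (d F x (E j))) hv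
      simp only [ip_zero_left] at h1
      rw [← hb, map_sum, ← ipForm_apply, map_sum, LinearMap.sum_apply,
        Finset.sum_eq_single j] at h1
      · rw [map_smul, h.d_combination_eq hE hE', smul_smul, ipForm_apply, ip_smul_left] at h1
        have h2 := hE j j
        rw [firstForm, if_pos rfl] at h2
        rw [h2, mul_one] at h1
        exact (mul_eq_zero.mp h1).resolve_right (hne x j)
      · intro i _ hij
        rw [map_smul, h.d_combination_eq hE hE', smul_smul, ipForm_apply, ip_smul_left]
        have h2 := hE i j
        rw [firstForm, if_neg hij] at h2
        rw [h2, mul_zero]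
      · simp
    rw [← hb]
    simp [hz]
  normal_smooth := h.contMDiff_combination _ _
  normal_tangent hε x := h.ip_combination_tangent hε c s x
  normal_unit x := h.ip_combination_normal hcs x
  normal_orthogonal x v := h.ip_combination_d _ _ _ _ (by rintro rfl; simp) x v

end IsOrientedHypersurface

end Geometry

/-! ### Generalized trigonometry and the product `∏ (c - k i s)` -/

section Scalar

variable {ε : SignType} {n : ℕ}

theorem C_sq_add_S_sq (ε : SignType) (μ : ℝ) : C ε μ ^ 2 + ε * S ε μ ^ 2 = 1 := by
  rcases ε.trichotomy with rfl | rfl | rfl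
  · change Real.cosh μ ^ 2 + ((-1 : SignType) : ℝ) * Real.sinh μ ^ 2 = 1
    simp [Real.cosh_sq]
  · change (1 : ℝ) ^ 2 + ((0 : SignType) : ℝ) * μ ^ 2 = 1
    simp
  · change Real.cos μ ^ 2 + ((1 : SignType) : ℝ) * Real.sin μ ^ 2 = 1
    simp

theorem C_apply_zero (ε : SignType) : C ε 0 = 1 := by
  cases ε <;> simp [C]

theorem S_apply_zero (ε : SignType) : S ε 0 = 0 := by
  cases ε <;> simp [S]

theorem C_neg_one_pos (hε : ε = -1) (μ : ℝ) : 0 < C ε μ := by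
  subst hε
  exact Real.cosh_pos μ

theorem contDiff_C (ε : SignType) {m : WithTop ℕ∞} : ContDiff ℝ m (C ε) := by
  rcases ε.trichotomy with rfl | rfl | rfl
  · exact Real.contDiff_cosh
  · exact contDiff_const
  · exact Real.contDiff_cos

theorem contDiff_S (ε : SignType) {m : WithTop ℕ∞} : ContDiff ℝ m (S ε) := by
  rcases ε.trichotomy with rfl | rfl | rfl
  · exact Real.contDiff_sinh
  · exact contDiff_id
  · exact Real.contDiff_sin

theorem hasDerivAt_C (ε : SignType) (μ : ℝ) : HasDerivAt (C ε) (-(ε * S ε μ)) μ := by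
  rcases ε.trichotomy with rfl | rfl | rfl
  · simpa using! Real.hasDerivAt_cosh μ
  · simpa using! hasDerivAt_const μ (1 : ℝ)
  · simpa using! Real.hasDerivAt_cos μ

theorem hasDerivAt_S (ε : SignType) (μ : ℝ) : HasDerivAt (S ε) (C ε μ) μ := by
  rcases ε.trichotomy with rfl | rfl | rfl
  · exact Real.hasDerivAt_sinh μ
  · exact hasDerivAt_id μ
  · exact Real.hasDerivAt_sin μ

/-- The mean curvature of the hypersurface parallel to one with principal curvatures `k i`, at the
distance whose generalized cosine and sine are `c` and `s`. -/
def parallelMean (ε : SignType) (k : Fin n → ℝ) (c s : ℝ) : ℝ :=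
  ∑ i, (ε * s + k i * c) / (c - k i * s)

/-- Here `r` plays the role of `μ'`, and each factor has derivative `-(ε s + k i c) r`. No distance
function is mentioned, so the lemma applies before a smooth one is known. -/
theorem hasDerivWithinAt_prod {k : Fin n → ℝ} {c s : ℝ → ℝ} {I : Set ℝ} {t r : ℝ}
    (hc : HasDerivWithinAt c (-(ε * s t) * r) I t) (hs : HasDerivWithinAt s (c t * r) I t)
    (hne : ∀ i, c t - k i * s t ≠ 0) :
    HasDerivWithinAt (fun τ => ∏ i, (c τ - k i * s τ))
      (-(r * parallelMean ε k (c t) (s t)) * ∏ i, (c t - k i * s t)) I t := by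
  refine (HasDerivWithinAt.fun_finsetProd (u := Finset.univ)
    fun i _ => hc.sub (hs.const_mul (k i))).congr_deriv ?_
  rw [parallelMean, Finset.mul_sum, ← Finset.sum_neg_distrib, Finset.sum_mul]
  refine Finset.sum_congr rfl fun i _ => ?_
  rw [← Finset.mul_prod_erase Finset.univ (fun j => c t - k j * s t) (Finset.mem_univ i),
    smul_eq_mul]
  change (∏ j ∈ Finset.univ.erase i, (c t - k j * s t)) * _ = _
  obtain ⟨u, hu⟩ : ∃ u, u = c t - k i * s t := ⟨_, rfl⟩
  have hu0 : u ≠ 0 := hu ▸ hne i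
  rw [← hu]
  generalize ∏ j ∈ Finset.univ.erase i, (c t - k j * s t) = P
  field_simp
  ring

theorem IsTimeInterval.convex {I : Set ℝ} (hI : IsTimeInterval I) : Convex ℝ I :=
  hI.ordConnected.convex

theorem IsTimeInterval.uniqueDiffOn {I : Set ℝ} (hI : IsTimeInterval I) : UniqueDiffOn ℝ I := by
  refine uniqueDiffOn_convex hI.convex ?_
  obtain ⟨a, ha, b, hb, hab⟩ := hI.nontrivial.exists_lt
  exact (Set.nonempty_Ioo.mpr hab).mono
    (interior_Icc (a := a) (b := b) ▸ interior_mono (hI.ordConnected.out ha hb))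

/-- The function `f t * exp (-t)` has zero derivative on an interval. -/
theorem eq_exp_of_hasDerivWithinAt {I : Set ℝ} (hI : IsTimeInterval I) {f : ℝ → ℝ} (h0 : f 0 = 1)
    (hf : ∀ t ∈ I, HasDerivWithinAt f (f t) I t) {t : ℝ} (ht : t ∈ I) : f t = Real.exp t := by
  have hd : ∀ t ∈ I, HasDerivWithinAt (fun t => f t * Real.exp (-t)) 0 I t := fun t ht => by
    refine ((hf t ht).mul (hasDerivAt_neg t).exp.hasDerivWithinAt).congr_deriv ?_
    ring
  have := hI.convex.norm_image_sub_le_of_norm_hasDerivWithin_le (C := 0) hd (by simp) hI.zero_mem ht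
  simp only [h0, neg_zero, Real.exp_zero, mul_one, zero_mul, norm_le_zero_iff, sub_eq_zero] at this
  rw [Real.exp_neg] at this
  field_simp at this
  exact this

/-- The system of ordinary differential equations for the generalized cosine and sine of the
distance covered by the flow. -/
structure IsFlowSystem (ε : SignType) (k : Fin n → ℝ) (I : Set ℝ) (c s : ℝ → ℝ) : Prop where
  cos_zero : c 0 = 1
  sin_zero : s 0 = 0
  unit : ∀ t ∈ I, c t ^ 2 + ε * s t ^ 2 = 1
  ne_zero : ∀ t ∈ I, ∀ i, c t - k i * s t ≠ 0
  mean_ne_zero : ∀ t ∈ I, parallelMean ε k (c t) (s t) ≠ 0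
  deriv_cos : ∀ t ∈ I,
    HasDerivWithinAt c (-(ε * s t) * -(1 / parallelMean ε k (c t) (s t))) I t
  deriv_sin : ∀ t ∈ I, HasDerivWithinAt s (c t * -(1 / parallelMean ε k (c t) (s t))) I t

/-! ### Consequences of the flow system -/

namespace IsFlowSystem

variable {k : Fin n → ℝ} {I : Set ℝ} {c s : ℝ → ℝ}

theorem prod_eq_exp (h : IsFlowSystem ε k I c s) (hI : IsTimeInterval I) {t : ℝ} (ht : t ∈ I) :
    ∏ i, (c t - k i * s t) = Real.exp t := by
  refine eq_exp_of_hasDerivWithinAt hI (f := fun t => ∏ i, (c t - k i * s t)) ?_ (fun t ht => ?_) ht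
  · simp [h.cos_zero, h.sin_zero]
  · refine (hasDerivWithinAt_prod (h.deriv_cos t ht) (h.deriv_sin t ht)
      (h.ne_zero t ht)).congr_deriv ?_
    rw [neg_mul, neg_mul, neg_mul, neg_neg, one_div_mul_cancel (h.mean_ne_zero t ht), one_mul]

/-- Bootstrapping: the derivatives of `c` and `s` are rational in `c`, `s` with nonvanishing
denominators, so each order of smoothness yields the next. -/
theorem contDiffOn (h : IsFlowSystem ε k I c s) (hI : IsTimeInterval I) :
    ContDiffOn ℝ ∞ c I ∧ ContDiffOn ℝ ∞ s I := by
  have hu := hI.uniqueDiffOn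
  have key : ∀ m : ℕ, ContDiffOn ℝ m c I ∧ ContDiffOn ℝ m s I := by
    intro m
    induction m with
    | zero =>
      exact ⟨contDiffOn_zero.mpr fun t ht => (h.deriv_cos t ht).continuousWithinAt,
        contDiffOn_zero.mpr fun t ht => (h.deriv_sin t ht).continuousWithinAt⟩
    | succ m ih =>
      obtain ⟨hc, hs⟩ := ih
      have hm : ContDiffOn ℝ m (fun t => parallelMean ε k (c t) (s t)) I :=
        ContDiffOn.sum fun i _ => ((contDiffOn_const.mul hs).add (contDiffOn_const.mul hc)).div
          (hc.sub (contDiffOn_const.mul hs)) fun t ht => h.ne_zero t ht i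
      have hr : ContDiffOn ℝ m (fun t => -(1 / parallelMean ε k (c t) (s t))) I :=
        (contDiffOn_const.div hm h.mean_ne_zero).neg
      push_cast
      constructor
      · refine (contDiffOn_succ_iff_derivWithin hu).mpr
          ⟨fun t ht => (h.deriv_cos t ht).differentiableWithinAt, by simp, ?_⟩
        exact ((contDiffOn_const.mul hs).neg.mul hr).congr fun t ht =>
          (h.deriv_cos t ht).derivWithin (hu t ht)
      · refine (contDiffOn_succ_iff_derivWithin hu).mpr
          ⟨fun t ht => (h.deriv_sin t ht).differentiableWithinAt, by simp, ?_⟩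
        exact (hc.mul hr).congr fun t ht => (h.deriv_sin t ht).derivWithin (hu t ht)
  exact ⟨contDiffOn_infty.mpr fun m => (key m).1, contDiffOn_infty.mpr fun m => (key m).2⟩

/-- The factors of the product are positive. -/
theorem sub_mul_pos (h : IsFlowSystem ε k I c s) (hI : IsTimeInterval I) {t : ℝ} (ht : t ∈ I)
    (i : Fin n) : 0 < c t - k i * s t := by
  obtain ⟨hc, hs⟩ := h.contDiffOn hI
  have hcont : ContinuousOn (fun t => c t - k i * s t) I :=
    hc.continuousOn.sub (continuousOn_const.mul hs.continuousOn)
  by_contra! hneg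
  obtain ⟨τ, hτ, h0⟩ := hI.convex.isPreconnected.intermediate_value ht hI.zero_mem hcont
    (show (0 : ℝ) ∈ Set.Icc _ _ from ⟨hneg, by simp [h.cos_zero, h.sin_zero]⟩)
  exact h.ne_zero τ hτ i h0

end IsFlowSystem

/-- The point of the unit circle with `c - k s > 0` has the angle
`arctan ((s + k c) / (c - k s)) - arctan k`. -/
theorem cos_sin_arctan_sub_arctan {c s k : ℝ} (hcs : c ^ 2 + s ^ 2 = 1) (hpos : 0 < c - k * s) :
    Real.cos (Real.arctan ((s + k * c) / (c - k * s)) - Real.arctan k) = c ∧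
      Real.sin (Real.arctan ((s + k * c) / (c - k * s)) - Real.arctan k) = s := by
  obtain ⟨u, hu⟩ : ∃ u, u = c - k * s := ⟨_, rfl⟩
  rw [← hu] at hpos ⊢
  have hk : 0 < 1 + k ^ 2 := by positivity
  have hsq : √(1 + k ^ 2) * √(1 + k ^ 2) = 1 + k ^ 2 := Real.mul_self_sqrt hk.le
  have hsk : √(1 + k ^ 2) ≠ 0 := (Real.sqrt_pos.mpr hk).ne'
  -- The vector `(c - k s, s + k c)` is `(c, s)` rotated by `arctan k` and stretched by `√(1 + k²)`,
  -- so its squared length is `1 + k²`.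
  have hr : √(1 + ((s + k * c) / u) ^ 2) = √(1 + k ^ 2) / u := by
    rw [← Real.sqrt_sq hpos.le, ← Real.sqrt_div hk.le, Real.sqrt_sq hpos.le]
    congr 1
    field_simp
    rw [hu]
    linear_combination (1 + k ^ 2) * hcs
  have h1 : Real.cos (Real.arctan ((s + k * c) / u)) = u / √(1 + k ^ 2) := by
    rw [Real.cos_arctan, hr, one_div_div]
  have h2 : Real.sin (Real.arctan ((s + k * c) / u)) = (s + k * c) / √(1 + k ^ 2) := by
    rw [Real.sin_arctan, hr]
    field_simp
  rw [Real.cos_sub, Real.sin_sub, h1, h2, Real.cos_arctan, Real.sin_arctan]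
  constructor
  · rw [div_mul_div_comm, div_mul_div_comm, ← add_div, hsq, div_eq_iff hk.ne', hu]
    ring
  · rw [div_mul_div_comm, div_mul_div_comm, ← sub_div, hsq, div_eq_iff hk.ne', hu]
    ring

/-- Only `ε = 1` is delicate, the angle being determined up to periods. The curve `(c, s)` stays in
the half-plane `c - k i s > 0`, so one branch of the angle serves for all times. -/
theorem IsFlowSystem.exists_isDistanceFunction {k : Fin n → ℝ} {I : Set ℝ} {c s : ℝ → ℝ}
    (h : IsFlowSystem ε k I c s) (hI : IsTimeInterval I) (h0 : ε = 0 → ∀ t ∈ I, c t = 1)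
    (hneg : ε = -1 → ∀ t ∈ I, 0 < c t) :
    ∃ ν : ℝ → ℝ, IsDistanceFunction ε k I ν ∧ ∀ t ∈ I, C ε (ν t) = c t ∧ S ε (ν t) = s t := by
  obtain ⟨hc, hs⟩ := h.contDiffOn hI
  suffices ∃ ν : ℝ → ℝ, ContDiffOn ℝ ∞ ν I ∧ ν 0 = 0 ∧ ∀ t ∈ I, C ε (ν t) = c t ∧ S ε (ν t) = s t by
    obtain ⟨ν, hν, hν0, hνI⟩ := this
    refine ⟨ν, ⟨hν, hν0, fun t ht => ?_⟩, hνI⟩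
    rw [(hνI t ht).1, (hνI t ht).2]
    exact h.prod_eq_exp hI ht
  have hunit := h.unit
  rcases ε.trichotomy with rfl | rfl | rfl
  · refine ⟨fun t => Real.arsinh (s t), hs.arsinh, by simp [h.sin_zero], fun t ht => ?_⟩
    refine ⟨?_, Real.sinh_arsinh _⟩
    change Real.cosh (Real.arsinh (s t)) = c t
    have := hunit t ht
    simp only [SignType.coe_neg, SignType.coe_one] at this
    rw [Real.cosh_arsinh, show 1 + s t ^ 2 = c t ^ 2 by linarith, Real.sqrt_sq (hneg rfl t ht).le]
  · exact ⟨s, hs, h.sin_zero, fun t ht => ⟨(h0 rfl t ht).symm, rfl⟩⟩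
  -- Choosing the half-plane needs an index; for `n = 0` the mean curvature would be an empty sum,
  -- hence zero.
  · have hn : Nonempty (Fin n) := by
      by_contra hn
      rw [not_nonempty_iff] at hn
      exact h.mean_ne_zero 0 hI.zero_mem (by simp [parallelMean])
    obtain ⟨i⟩ := hn
    refine ⟨fun t => Real.arctan ((s t + k i * c t) / (c t - k i * s t)) - Real.arctan (k i),
      ?_, by simp [h.sin_zero, h.cos_zero], fun t ht => ?_⟩
    · exact (((hs.add (contDiffOn_const.mul hc)).div (hc.sub (contDiffOn_const.mul hs))
        fun t ht => h.ne_zero t ht i).arctan).sub contDiffOn_const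
    · refine cos_sin_arctan_sub_arctan ?_ (h.sub_mul_pos hI ht i)
      simpa using hunit t ht

/-! ### Solutions of the algebraic equation -/

namespace IsDistanceFunction

variable {k : Fin n → ℝ} {I : Set ℝ} {μ : ℝ → ℝ}

theorem sub_mul_ne_zero (h : IsDistanceFunction ε k I μ) {t : ℝ} (ht : t ∈ I) (i : Fin n) :
    C ε (μ t) - k i * S ε (μ t) ≠ 0 := fun h0 =>
  (Real.exp_pos t).ne' ((h.equation t ht).symm.trans (Finset.prod_eq_zero (Finset.mem_univ i) h0))

/-- Logarithmic differentiation of the equation: the left side gives `-μ' * parallelMean`, the right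
side `1`. -/
theorem derivWithin_mul (h : IsDistanceFunction ε k I μ) (hI : IsTimeInterval I) {t : ℝ}
    (ht : t ∈ I) :
    derivWithin μ I t * parallelMean ε k (C ε (μ t)) (S ε (μ t)) = -1 := by
  have hd := (h.smooth.differentiableOn (by simp) t ht).hasDerivWithinAt
  have h1 := hasDerivWithinAt_prod (k := k) (c := C ε ∘ μ) (s := S ε ∘ μ)
    ((hasDerivAt_C ε (μ t)).comp_hasDerivWithinAt t hd)
    ((hasDerivAt_S ε (μ t)).comp_hasDerivWithinAt t hd) (h.sub_mul_ne_zero ht)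
  have h2 : HasDerivWithinAt (fun τ => ∏ i, (C ε (μ τ) - k i * S ε (μ τ))) (Real.exp t) I t :=
    (Real.hasDerivAt_exp t).hasDerivWithinAt.congr h.equation (h.equation t ht)
  have h3 := (hI.uniqueDiffOn t ht).eq_deriv _ h1 h2
  simp only [Function.comp_apply, h.equation t ht] at h3
  have := Real.exp_pos t
  have : (derivWithin μ I t * parallelMean ε k (C ε (μ t)) (S ε (μ t)) + 1) * Real.exp t = 0 := by
    linear_combination -h3
  linarith [(mul_eq_zero.mp this).resolve_right (Real.exp_pos t).ne']

theorem parallelMean_ne_zero (h : IsDistanceFunction ε k I μ) (hI : IsTimeInterval I) {t : ℝ}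
    (ht : t ∈ I) : parallelMean ε k (C ε (μ t)) (S ε (μ t)) ≠ 0 := fun h0 => by
  have := h.derivWithin_mul hI ht
  rw [h0, mul_zero] at this
  norm_num at this

theorem hasDerivWithinAt (h : IsDistanceFunction ε k I μ) (hI : IsTimeInterval I) {t : ℝ}
    (ht : t ∈ I) :
    HasDerivWithinAt μ (-(1 / parallelMean ε k (C ε (μ t)) (S ε (μ t)))) I t := by
  refine (h.smooth.differentiableOn (by simp) t ht).hasDerivWithinAt.congr_deriv ?_
  have := h.parallelMean_ne_zero hI ht
  field_simp
  exact h.derivWithin_mul hI ht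

/-- A continuous function without zeros on an interval keeps the sign of its value `∑ k i` at time
`0`. -/
theorem parallelMean_pos (h : IsDistanceFunction ε k I μ) (hI : IsTimeInterval I)
    (hk : 0 < ∑ i, k i) {t : ℝ} (ht : t ∈ I) :
    0 < parallelMean ε k (C ε (μ t)) (S ε (μ t)) := by
  have hC := ((contDiff_C ε (m := ∞)).continuous.comp_continuousOn h.smooth.continuousOn)
  have hS := ((contDiff_S ε (m := ∞)).continuous.comp_continuousOn h.smooth.continuousOn)
  have hcont : ContinuousOn (fun t => parallelMean ε k (C ε (μ t)) (S ε (μ t))) I :=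
    continuousOn_finsetSum _ fun i _ =>
      ((continuousOn_const.mul hS).add (continuousOn_const.mul hC)).div
        (hC.sub (continuousOn_const.mul hS)) fun t ht => h.sub_mul_ne_zero ht i
  by_contra! hneg
  obtain ⟨τ, hτ, h0⟩ := hI.convex.isPreconnected.intermediate_value ht hI.zero_mem hcont
    (show (0 : ℝ) ∈ Set.Icc _ _ from
      ⟨hneg, by simpa [h.initial, C_apply_zero, S_apply_zero, parallelMean] using hk.le⟩)
  exact h.parallelMean_ne_zero hI hτ h0

/-- The images of `μ₁` and `μ₂` share the point `0`, so their union is an interval. The product `p`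
has nonzero derivative on it, hence is injective there by Rolle, and `p (μ₁ t) = p (μ₂ t)`. -/
theorem eqOn {μ₁ μ₂ : ℝ → ℝ} (h₁ : IsDistanceFunction ε k I μ₁) (h₂ : IsDistanceFunction ε k I μ₂)
    (hI : IsTimeInterval I) : Set.EqOn μ₁ μ₂ I := by
  set p : ℝ → ℝ := fun m => ∏ i, (C ε m - k i * S ε m) with hp
  have hJ : (μ₁ '' I ∪ μ₂ '' I).OrdConnected :=
    (IsPreconnected.union (s := μ₁ '' I) (t := μ₂ '' I) 0 ⟨0, hI.zero_mem, h₁.initial⟩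
      ⟨0, hI.zero_mem, h₂.initial⟩ (hI.convex.isPreconnected.image _ h₁.smooth.continuousOn)
      (hI.convex.isPreconnected.image _ h₂.smooth.continuousOn)).ordConnected
  have hd : ∀ m ∈ μ₁ '' I ∪ μ₂ '' I, ∃ q, q ≠ 0 ∧ HasDerivAt p q m := by
    have main : ∀ {μ : ℝ → ℝ}, IsDistanceFunction ε k I μ → ∀ t ∈ I,
        ∃ q, q ≠ 0 ∧ HasDerivAt p q (μ t) := fun {μ} h t ht => by
      refine ⟨-(1 * parallelMean ε k (C ε (μ t)) (S ε (μ t))) *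
        ∏ i, (C ε (μ t) - k i * S ε (μ t)), ?_, ?_⟩
      · rw [h.equation t ht, one_mul]
        exact mul_ne_zero (neg_ne_zero.mpr (h.parallelMean_ne_zero hI ht)) (Real.exp_pos t).ne'
      · rw [← hasDerivWithinAt_univ]
        exact hasDerivWithinAt_prod (by simpa using! hasDerivAt_C ε (μ t))
          (by simpa using! hasDerivAt_S ε (μ t)) (h.sub_mul_ne_zero ht)
    rintro m (⟨t, ht, rfl⟩ | ⟨t, ht, rfl⟩)
    · exact main h₁ t ht
    · exact main h₂ t ht
  have hlt : ∀ a ∈ μ₁ '' I ∪ μ₂ '' I, ∀ b ∈ μ₁ '' I ∪ μ₂ '' I, p a = p b → ¬a < b := by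
    intro a ha b hb hab hlt
    have hsub := hJ.out ha hb
    obtain ⟨m, hm, hm0⟩ := exists_deriv_eq_zero hlt
      (fun m hm => (hd m (hsub hm)).choose_spec.2.continuousAt.continuousWithinAt) hab
    obtain ⟨q, hq, hqd⟩ := hd m (hsub (Set.Ioo_subset_Icc_self hm))
    exact hq (hqd.deriv.symm.trans hm0)
  intro t ht
  have heq : p (μ₁ t) = p (μ₂ t) := (h₁.equation t ht).trans (h₂.equation t ht).symm
  have m₁ : μ₁ t ∈ μ₁ '' I ∪ μ₂ '' I := Or.inl ⟨t, ht, rfl⟩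
  have m₂ : μ₂ t ∈ μ₁ '' I ∪ μ₂ '' I := Or.inr ⟨t, ht, rfl⟩
  exact le_antisymm (not_lt.mp (hlt _ m₂ _ m₁ heq.symm)) (not_lt.mp (hlt _ m₁ _ m₂ heq))

end IsDistanceFunction

/-- The product `p` has value `1` and derivative `-∑ k i` at `0`; the distance is its local inverse
composed with `exp`. -/
theorem exists_isDistanceFunction (ε : SignType) {k : Fin n → ℝ} (hk : ∑ i, k i ≠ 0) :
    ∃ I : Set ℝ, IsOpen I ∧ IsTimeInterval I ∧ ∃ μ : ℝ → ℝ, IsDistanceFunction ε k I μ := by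
  set p : ℝ → ℝ := fun m => ∏ i, (C ε m - k i * S ε m) with hp
  have hp0 : p 0 = 1 := by simp [hp, C_apply_zero, S_apply_zero]
  -- Order `ω` instead of `∞`: smoothness at a point in the sense of `ContDiffAt ℝ ∞` need not
  -- spread to a neighbourhood, as the neighbourhoods may shrink with the order; analyticity does.
  have hsm : ContDiffAt ℝ ω p 0 :=
    (contDiff_prod fun i _ => (contDiff_C ε).sub (contDiff_const.mul (contDiff_S ε))).contDiffAt
  have hder : HasDerivAt p (-∑ i, k i) 0 := by
    have := hasDerivWithinAt_prod (ε := ε) (k := k) (c := C ε) (s := S ε) (I := Set.univ) (t := 0)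
      (r := 1) (by simpa using! hasDerivAt_C ε 0) (by simpa using! hasDerivAt_S ε 0)
      (by simp [C_apply_zero, S_apply_zero])
    simpa [parallelMean, C_apply_zero, S_apply_zero] using! this
  have hf : HasFDerivAt p (ContinuousLinearEquiv.unitsEquivAut ℝ (Units.mk0 _ (neg_ne_zero.mpr hk)) :
      ℝ →L[ℝ] ℝ) 0 := hder.hasFDerivAt_equiv (neg_ne_zero.mpr hk)
  set g := hsm.localInverse hf (by simp) with hg
  have hg0 : g 1 = 0 := hp0 ▸ hsm.localInverse_apply_image hf (by simp)
  have hgs : ContDiffAt ℝ ω g 1 := hp0 ▸ hsm.to_localInverse hf (by simp)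
  have hinv : ∀ᶠ y in nhds (1 : ℝ), p (g y) = y :=
    hp0 ▸ (hsm.hasStrictFDerivAt' hf (by simp)).eventually_right_inverse
  have hexp : Filter.Tendsto Real.exp (nhds 0) (nhds 1) := by
    simpa using (Real.continuous_exp.tendsto 0)
  have hev := hexp.eventually (hinv.and (hgs.eventually (by simp)))
  obtain ⟨δ, hδ, hball⟩ := Metric.eventually_nhds_iff_ball.mp hev
  refine ⟨Metric.ball 0 δ, Metric.isOpen_ball, ⟨(convex_ball _ _).ordConnected, ?_, by simpa⟩,
    fun t => g (Real.exp t), ?_, by simp [hg0], fun t ht => (hball t ht).1⟩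
  · exact ⟨0, by simpa, δ / 2, by simp [abs_of_pos hδ, hδ], by positivity⟩
  · exact fun t ht => (((hball t ht).2.of_le (by simp)).comp t
      Real.contDiff_exp.contDiffAt).contDiffWithinAt

end Scalar

/-! ### Recovering the principal curvatures from the flow -/

section Multiplicity

variable {ε : SignType} {n : ℕ}

/-- Two families with the same values, counted with multiplicity, differ by a permutation. -/
theorem exists_perm_of_map_eq {ι α : Type*} [Fintype ι] {f g : ι → α}
    (h : Multiset.map f Finset.univ.val = Multiset.map g Finset.univ.val) :
    ∃ σ : Equiv.Perm ι, ∀ i, g (σ i) = f i := by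
  classical
  have hcard : ∀ a, Fintype.card {i // f i = a} = Fintype.card {i // g i = a} := fun a => by
    have := congrArg (Multiset.count a) h
    simp only [Multiset.count_map] at this
    simpa [Fintype.card_subtype, Finset.card, Finset.filter_val, eq_comm] using this
  exact ⟨Equiv.ofFiberEquiv fun a => Fintype.equivOfCardEq (hcard a),
    fun i => Equiv.ofFiberEquiv_map _ i⟩

theorem exists_perm_of_eval_eq {k k' : Fin n → ℝ} {T : Set ℝ} (hT : T.Infinite)
    (h : ∀ y ∈ T, ∏ i, (y - k i) = ∏ i, (y - k' i)) :
    ∃ σ : Equiv.Perm (Fin n), ∀ i, k' (σ i) = k i := by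
  have hp : ∏ i, (Polynomial.X - Polynomial.C (k i)) = ∏ i, (Polynomial.X - Polynomial.C (k' i)) :=
    Polynomial.eq_of_infinite_eval_eq _ _ (hT.mono fun y hy => by
      simpa [Polynomial.eval_prod] using h y hy)
  have hroots : ∀ f : Fin n → ℝ, (∏ i, (Polynomial.X - Polynomial.C (f i))).roots =
      Multiset.map f Finset.univ.val := fun f => by
    rw [← Polynomial.roots_multiset_prod_X_sub_C (Multiset.map f Finset.univ.val),
      Multiset.map_map]
    rfl
  exact exists_perm_of_map_eq (by rw [← hroots, ← hroots, hp])

/-- If `s = 0` then `|c| = 1`, so the product `e^t` has absolute value `1`. -/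
theorem IsFlowSystem.sin_ne_zero {k : Fin n → ℝ} {I : Set ℝ} {c s : ℝ → ℝ}
    (h : IsFlowSystem ε k I c s) (hI : IsTimeInterval I) {t : ℝ} (ht : t ∈ I) (h0 : t ≠ 0) :
    s t ≠ 0 := fun hs => by
  have h1 := h.prod_eq_exp hI ht
  have h2 := h.unit t ht
  rw [hs] at h2
  have h3 : |c t| = 1 := by
    rw [← sq_eq_sq₀ (abs_nonneg _) zero_le_one, sq_abs]
    linarith
  have h4 := congrArg abs h1
  rw [Finset.abs_prod, Real.abs_exp] at h4
  simp only [hs, mul_zero, sub_zero, h3, Finset.prod_const_one] at h4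
  exact h0 (Real.exp_eq_one_iff t |>.mp h4.symm)

/-- The ratio `y = c / s` determines `|s|` through `(y² + ε) s² = 1`, and so also `e^t = ∏ |y - k i|
|s|`. -/
theorem IsFlowSystem.cot_injOn {k : Fin n → ℝ} {I : Set ℝ} {c s : ℝ → ℝ}
    (h : IsFlowSystem ε k I c s) (hI : IsTimeInterval I) :
    Set.InjOn (fun t => c t / s t) (I \ {0}) := by
  rintro t ⟨ht, ht0⟩ τ ⟨hτ, hτ0⟩ heq
  have hst := h.sin_ne_zero hI ht ht0
  have hsτ := h.sin_ne_zero hI hτ hτ0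
  simp only at heq
  obtain ⟨y, hy⟩ : ∃ y, y = c τ / s τ := ⟨_, rfl⟩
  rw [← hy, div_eq_iff hst] at heq
  rw [eq_div_iff hsτ] at hy
  have u1 := h.unit t ht
  have u2 := h.unit τ hτ
  have p1 := h.prod_eq_exp hI ht
  have p2 := h.prod_eq_exp hI hτ
  rw [heq] at u1 p1
  rw [← hy] at u2 p2
  have hy2 : y ^ 2 + ε ≠ 0 := fun h0 => by
    have : (y ^ 2 + ε) * s t ^ 2 = 1 := by linear_combination u1
    rw [h0, zero_mul] at this
    exact zero_ne_one this
  have hsq : s t ^ 2 = s τ ^ 2 := mul_left_cancel₀ hy2 (by linear_combination u1 - u2)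
  have habs : |s t| = |s τ| := (sq_eq_sq_iff_abs_eq_abs _ _).mp hsq
  have : Real.exp t = Real.exp τ := by
    rw [← Real.abs_exp t, ← Real.abs_exp τ, ← p1, ← p2, Finset.abs_prod, Finset.abs_prod]
    refine Finset.prod_congr rfl fun i _ => ?_
    rw [← sub_mul, ← sub_mul, abs_mul, abs_mul, habs]
  exact Real.exp_injective this

theorem IsTimeInterval.infinite {I : Set ℝ} (hI : IsTimeInterval I) : I.Infinite := by
  obtain ⟨a, ha, b, hb, hab⟩ := hI.nontrivial.exists_lt
  exact (Set.Icc_infinite hab).mono (hI.ordConnected.out ha hb)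

/-- Principal curvatures which undergo the same flow agree up to their order. -/
theorem IsFlowSystem.exists_perm {k k' : Fin n → ℝ} {I : Set ℝ} {c s : ℝ → ℝ}
    (h : IsFlowSystem ε k I c s) (h' : IsFlowSystem ε k' I c s) (hI : IsTimeInterval I) :
    ∃ σ : Equiv.Perm (Fin n), ∀ i, k' (σ i) = k i := by
  refine exists_perm_of_eval_eq (T := (fun t => c t / s t) '' (I \ {0}))
    ((hI.infinite.sdiff (Set.finite_singleton 0)).image (h.cot_injOn hI)) ?_
  rintro _ ⟨t, ⟨ht, ht0⟩, rfl⟩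
  have hs := h.sin_ne_zero hI ht ht0
  have key : ∀ f : Fin n → ℝ, ∏ i, (c t / s t - f i) = (∏ i, (c t - f i * s t)) / s t ^ n :=
    fun f => by
      rw [← Fin.prod_const, ← Finset.prod_div_distrib]
      refine Finset.prod_congr rfl fun i _ => ?_
      field_simp
  simp only [key, h.prod_eq_exp hI ht, h'.prod_eq_exp hI ht]

variable {M : Type*} [TopologicalSpace M] [ChartedSpace (EuclideanSpace ℝ (Fin n)) M]

theorem IsPrincipalCurvatures.comp_perm {F N : M → Ambient ε n} {x : M} {k : Fin n → ℝ}
    (h : IsPrincipalCurvatures F N x k) (σ : Equiv.Perm (Fin n)) :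
    IsPrincipalCurvatures F N x fun i => k (σ i) := by
  obtain ⟨E, h1, h2⟩ := h
  exact ⟨fun i => E (σ i), fun i j => by simp [h1], fun i j => by simp [h2]⟩

end Multiplicity

/-! ### Parallel flows versus distance functions -/

section Flow

variable {ε : SignType} {n : ℕ} {M : Type*} [TopologicalSpace M]
  [ChartedSpace (EuclideanSpace ℝ (Fin n)) M] {F N : M → Ambient ε n}

theorem exists_isPrincipalCurvatures_of_meanCurvature_pos {x : M}
    (h : 0 < meanCurvature F N x) : ∃ k, IsPrincipalCurvatures F N x k := by
  by_contra hne
  rw [meanCurvature, dif_neg hne] at h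
  exact lt_irrefl 0 h

/-- A flow by parallel hypersurfaces is governed, at every point, by the ordinary differential
equations for the generalized cosine and sine of the distance. -/
theorem IsOrientedHypersurface.isFlowSystem (h : IsOrientedHypersurface F N)
    (hH : ∀ x, 0 < meanCurvature F N x) {I : Set ℝ} {G : ℝ → M → Ambient ε n}
    (hG : IsIMCF F I G) {μ : ℝ → ℝ} (hμ : ∀ t ∈ I, ∀ x, G t x = parallel F N (μ t) x) {x : M}
    {k : Fin n → ℝ} (hk : IsPrincipalCurvatures F N x k) :
    IsFlowSystem ε k I (fun t => C ε (μ t)) fun t => S ε (μ t) := by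
  obtain ⟨N', hN'⟩ := hG.flow
  have hGt : ∀ t ∈ I, G t = combination F N (C ε (μ t)) (S ε (μ t)) := fun t ht =>
    funext (hμ t ht)
  have hcos : ε = 0 → ∀ m, C ε m = 1 := by rintro rfl m; rfl
  have hFN : ε = 0 ∨ ip (F x) (N x) = 0 := by
    by_cases hε : ε = 0
    exacts [Or.inl hε, Or.inr (h.normal_tangent hε x)]
  -- The regularity of `c` and `s` comes from `G`, not from `μ`. The subtracted constant matters for
  -- `ε = 0`, where `C` is `1` and `F x` need not be orthogonal to `N x`.
  have hs : ∀ t ∈ I, S ε (μ t) = ip (G t x) (N x) - ip (F x) (N x) := fun t ht => by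
    rw [hGt t ht, combination, ip_add_left, ip_smul_left, ip_smul_left, h.normal_unit]
    rcases hFN with hε | h0
    · rw [hcos hε]; ring
    · rw [h0]; ring
  have hc : ε ≠ 0 → ∀ t ∈ I, C ε (μ t) = ε * ip (G t x) (F x) := fun hε t ht => by
    rw [hGt t ht, combination, ip_add_left, ip_smul_left, ip_smul_left, ip_comm (N x),
      h.ip_self hε, h.normal_tangent hε]
    linear_combination -C ε (μ t) * cast_mul_self_of_ne_zero hε
  have hor : ∀ t ∈ I, IsOrientedHypersurface (combination F N (C ε (μ t)) (S ε (μ t))) (N' t) :=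
    fun t ht => hGt t ht ▸ (hN' t ht).1
  have hflow : ∀ t ∈ I, parallelMean ε k (C ε (μ t)) (S ε (μ t)) ≠ 0 ∧
      HasDerivWithinAt (fun τ => G τ x) (-(1 / parallelMean ε k (C ε (μ t)) (S ε (μ t))) •
        combination F N (-(ε * S ε (μ t))) (C ε (μ t)) x) I t := fun t ht => by
    obtain ⟨σ, hσ, hν, hm⟩ := h.exists_sign (C_sq_add_S_sq ε (μ t)) (hor t ht)
      (fun y => exists_isPrincipalCurvatures_of_meanCurvature_pos (hH y)) hk
    obtain ⟨hpos, hd⟩ := (hN' t ht).2 x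
    change _ = σ * parallelMean ε k (C ε (μ t)) (S ε (μ t)) at hm
    rw [hGt t ht, hm] at hpos hd
    have hne : parallelMean ε k (C ε (μ t)) (S ε (μ t)) ≠ 0 := right_ne_zero_of_mul hpos.ne'
    refine ⟨hne, hd.congr_deriv ?_⟩
    -- The normal and its mean curvature carry the same sign `σ`, which cancels in the quotient.
    rw [hν, smul_smul]
    congr 1
    have hσ0 : σ ≠ 0 := left_ne_zero_of_mul_eq_one hσ
    field_simp
  have hip : ∀ w : Ambient ε n, ∀ t ∈ I, HasDerivWithinAt (fun τ => ip (G τ x) w)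
      (-(1 / parallelMean ε k (C ε (μ t)) (S ε (μ t))) *
        ip (combination F N (-(ε * S ε (μ t))) (C ε (μ t)) x) w) I t := fun w t ht => by
    have := ((ipCLM ε n).flip w).hasFDerivAt.comp_hasDerivWithinAt t (hflow t ht).2
    refine HasDerivWithinAt.congr_deriv this ?_
    rw [map_smul]
    rfl
  have h0 := hG.interval.zero_mem
  refine ⟨?_, ?_, fun t _ => C_sq_add_S_sq ε (μ t), fun t ht => ?_, fun t ht => (hflow t ht).1,
    fun t ht => ?_, fun t ht => ?_⟩
  · by_cases hε : ε = 0
    · exact hcos hε _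
    · rw [hc hε 0 h0, hG.initial, h.ip_self hε, cast_mul_self_of_ne_zero hε]
  · rw [hs 0 h0, hG.initial, sub_self]
  · exact h.sub_mul_ne_zero hk ((hor t ht).immersion x)
  · by_cases hε : ε = 0
    · refine ((hasDerivWithinAt_const t I (1 : ℝ)).congr_deriv ?_).congr
        (fun τ _ => hcos hε _) (hcos hε _)
      simp [hε]
    · refine (((hip (F x) t ht).const_mul (ε : ℝ)).congr_deriv ?_).congr (hc hε) (hc hε t ht)
      rw [combination, ip_add_left, ip_smul_left, ip_smul_left, ip_comm (N x), h.ip_self hε,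
        h.normal_tangent hε]
      linear_combination (1 / parallelMean ε k (C ε (μ t)) (S ε (μ t))) * (ε * S ε (μ t)) *
        cast_mul_self_of_ne_zero hε
  · refine (((hip (N x) t ht).sub_const (ip (F x) (N x))).congr_deriv ?_).congr hs (hs t ht)
    rw [combination, ip_add_left, ip_smul_left, ip_smul_left, h.normal_unit]
    rcases hFN with hε | h0
    · subst hε
      simp only [SignType.coe_zero]
      ring
    · rw [h0]; ring

/-- The distance functions of isoparametric hypersurfaces give solutions. -/
theorem IsOrientedHypersurface.isIMCFByParallels [Nonempty M] (h : IsOrientedHypersurface F N)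
    (hH : ∀ x, 0 < meanCurvature F N x) {k : Fin n → ℝ}
    (hk : HasConstantPrincipalCurvatures F N k) {I : Set ℝ} (hI : IsTimeInterval I) {μ : ℝ → ℝ}
    (hμ : IsDistanceFunction ε k I μ) {G : ℝ → M → Ambient ε n}
    (hG : ∀ t ∈ I, ∀ x, G t x = parallel F N (μ t) x) : IsIMCFByParallels F N I G := by
  have hsum : 0 < ∑ i, k i := by
    obtain ⟨x⟩ := ‹Nonempty M›
    rw [← meanCurvature_eq (hk x)]
    exact hH x
  refine ⟨⟨hI, fun x => ?_, fun t => combination F N (-(ε * S ε (μ t))) (C ε (μ t)),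
    fun t ht => ?_⟩, μ, hG⟩
  · rw [hG 0 hI.zero_mem, hμ.initial, parallel, C_apply_zero, S_apply_zero, one_smul, zero_smul,
      add_zero]
  have hGt : G t = combination F N (C ε (μ t)) (S ε (μ t)) := funext (hG t ht)
  have hmean : ∀ x, meanCurvature (G t) (combination F N (-(ε * S ε (μ t))) (C ε (μ t))) x =
      parallelMean ε k (C ε (μ t)) (S ε (μ t)) := fun x => by
    rw [hGt, meanCurvature_eq (h.isPrincipalCurvatures_combination (hk x) (σ := 1)
      (fun i => hμ.sub_mul_ne_zero ht i) (by simp only [one_mul]; rfl))]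
    simp [parallelMean]
  refine ⟨?_, fun x => ⟨?_, ?_⟩⟩
  · rw [hGt]
    exact h.combination_isOrientedHypersurface (C_sq_add_S_sq ε _) (fun hε => C_neg_one_pos hε _)
      hk fun x i => hμ.sub_mul_ne_zero ht i
  · rw [hmean]
    exact hμ.parallelMean_pos hI hsum ht
  · rw [hmean]
    have hd := hμ.hasDerivWithinAt hI ht
    have hc := ((hasDerivAt_C ε (μ t)).comp_hasDerivWithinAt t hd).smul_const (F x)
    have hs := ((hasDerivAt_S ε (μ t)).comp_hasDerivWithinAt t hd).smul_const (N x)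
    refine ((hc.add hs).congr_deriv ?_).congr (fun τ hτ => hG τ hτ x) (hG t ht x)
    simp only [combination, smul_add, smul_smul]
    rw [mul_comm (-(ε * S ε (μ t))),
      mul_comm (C ε (μ t))]

end Flow

end SpaceForm

end

theorem theorem3p5 (ε : SignType) (n : ℕ) {M : Type*} [TopologicalSpace M] [ConnectedSpace M]
    [ChartedSpace (EuclideanSpace ℝ (Fin n)) M] [IsManifold (𝓡 n) ∞ M]
    (F N : M → SpaceForm.Ambient ε n)
    (hF : SpaceForm.IsOrientedHypersurface F N)
    (hH : ∀ x, 0 < SpaceForm.meanCurvature F N x) :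
    -- flows by parallel hypersurfaces start exactly at isoparametric hypersurfaces
    ((∃ (I : Set ℝ) (G : ℝ → M → SpaceForm.Ambient ε n), SpaceForm.IsIMCFByParallels F N I G) ↔
      SpaceForm.IsIsoparametric F N) ∧
    -- for an isoparametric hypersurface with principal curvatures `k i` :
    ∀ k : Fin n → ℝ, SpaceForm.HasConstantPrincipalCurvatures F N k →
      -- a solution exists on an open interval
      (∃ I : Set ℝ, IsOpen I ∧ SpaceForm.IsTimeInterval I ∧
        ∃ μ : ℝ → ℝ, SpaceForm.IsDistanceFunction ε k I μ) ∧
      ∀ I : Set ℝ, SpaceForm.IsTimeInterval I →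
        -- the solutions on `I` are the families given by the algebraic equation
        (∀ G : ℝ → M → SpaceForm.Ambient ε n, SpaceForm.IsIMCFByParallels F N I G ↔
          ∃ μ : ℝ → ℝ, SpaceForm.IsDistanceFunction ε k I μ ∧
            ∀ t ∈ I, ∀ x, G t x = SpaceForm.parallel F N (μ t) x) ∧
        -- and the equation has at most one smooth solution on `I`
        (∀ μ₁ μ₂ : ℝ → ℝ, SpaceForm.IsDistanceFunction ε k I μ₁ →
          SpaceForm.IsDistanceFunction ε k I μ₂ → Set.EqOn μ₁ μ₂ I) := by
  have hpc : ∀ x, ∃ k, SpaceForm.IsPrincipalCurvatures F N x k := fun x =>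
    SpaceForm.exists_isPrincipalCurvatures_of_meanCurvature_pos (hH x)
  obtain ⟨x₀⟩ : Nonempty M := inferInstance
  have hex : ∀ k : Fin n → ℝ, SpaceForm.HasConstantPrincipalCurvatures F N k →
      ∃ I : Set ℝ, IsOpen I ∧ SpaceForm.IsTimeInterval I ∧
        ∃ μ : ℝ → ℝ, SpaceForm.IsDistanceFunction ε k I μ := fun k hk => by
    have := hH x₀
    rw [SpaceForm.meanCurvature_eq (hk x₀)] at this
    exact SpaceForm.exists_isDistanceFunction ε this.ne'
  refine ⟨⟨?_, ?_⟩, fun k hk => ⟨hex k hk, fun I hI => ⟨fun G => ⟨?_, ?_⟩, ?_⟩⟩⟩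
  · rintro ⟨I, G, hG, μ, hμ⟩
    obtain ⟨k, hk⟩ := hpc x₀
    refine ⟨k, fun x => ?_⟩
    obtain ⟨k', hk'⟩ := hpc x
    -- The same `μ` drives the flow system at `x₀` and at `x`.
    obtain ⟨σ, hσ⟩ := (hF.isFlowSystem hH hG hμ hk).exists_perm
      (hF.isFlowSystem hH hG hμ hk') hG.interval
    simpa only [hσ] using hk'.comp_perm σ
  · rintro ⟨k, hk⟩
    obtain ⟨I, -, hI, μ, hμ⟩ := hex k hk
    exact ⟨I, fun t => SpaceForm.parallel F N (μ t),
      hF.isIMCFByParallels hH hk hI hμ fun _ _ _ => rfl⟩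
  · rintro ⟨hG, μ, hμ⟩
    -- The given `μ` may fail to be smooth or to vanish at `0`; `ν` has the same generalized cosine
    -- and sine, hence the same parallel hypersurfaces.
    obtain ⟨ν, hν, hνμ⟩ := (hF.isFlowSystem hH hG hμ (hk x₀)).exists_isDistanceFunction hI
      (by rintro rfl t _; rfl) (fun hε t _ => SpaceForm.C_neg_one_pos hε _)
    refine ⟨ν, hν, fun t ht x => ?_⟩
    rw [hμ t ht x, SpaceForm.parallel, SpaceForm.parallel, (hνμ t ht).1, (hνμ t ht).2]
  · rintro ⟨μ, hμ, hG⟩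
    exact hF.isIMCFByParallels hH hk hI hμ hG
  · exact fun μ₁ μ₂ h₁ h₂ => h₁.eqOn h₂ hI
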